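/- Let $1\le \tau\le n$ and $K\ge 1$ be integers. Let $B$ be an $n\times n$ real symmetric positive definite matrix with eigenvalues $\lambda_1\ge\dots\ge\lambda_n$ and spectral decomposition $B=Q\,\mathrm{Diag}(\lambda_1,\dots,\lambda_n)\,Q^T$, where $Q$ is orthogonal, and let $$B_\tau := Q\,\mathrm{Diag}(\lambda_1,\dots,\lambda_\tau,\lambda_\tau,\dots,\lambda_\tau)\,Q^T+\Big(\sum_{i=\tau+1}^n\lambda_i\Big) I .$$ For a symmetric positive semidefinite matrix $A$ write $\|v\|_A:=\langle Av,v\rangle^{1/2}$. Let $f:\mathbb R^n\to\mathbb R$ be a differentiable function that is 1-smooth with respect to $\|\cdot\|_B$, i.e. $$f(y)\le f(x)+\langle\nabla f(x),y-x\rangle+\tfrac12\|y-x\|_B^2\qquad\text{for all }x,y\in\mathbb R^n,$$ and strongly convex with respect to $\|\cdot\|_{B_\tau}$ with constant $\mu_\tau>0$, i.e. $$f(y)\ge f(x)+\langle\nabla f(x),y-x\rangle+\tfrac{\mu_\tau}2\|y-x\|_{B_\tau}^2\qquad\text{for all }x,y\in\mathbb R^n$$ (for instance, with $\mu_\tau$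 the largest such constant). Let $x_0\in\mathbb R^n$ be deterministic, and let $x_1,\dots,x_K$ be the random points generated by the randomized coordinate descent method with volume sampling (RCDVS): $$x_{k+1}=x_k-I_{S_k}(B_{S_k\times S_k})^{-1}\nabla f(x_k)_{S_k},\qquad 0\le k\le K-1,$$ where $S_0,\dots,S_{K-1}$ are independent random $\tau$-element subsets of $\{1,\dots,n\}$ with $$\Pr(S_k=S)=\frac{\det B_{S\times S}}{\sum_{|S'|=\tau}\det B_{S'\times S'}}\qquad\text{for every }\tau\text{-element } S\subseteq\{1,\dots,n\}.$$ Here $B_{S\times S}$ is the principal submatrix of $B$ with rows and columns in $S$, $v_S$ is the subvector of $v$ with entries in $S$, and $I_S$ is the $n\times\tau$ matrix formed by the columns of the identity matrix with indices in $S$. Then $f$ attains its minimum, each $f(x_k)$ is integrable, and $$\mathbb E f(x_k)-\min f\le(1-\mu_\tau)^k\,(f(x_0)-\min f)\qquad\text{for all }0\le k\le K.$$ -/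

import Mathlib

open MeasureTheory ProbabilityTheory

noncomputable section

namespace RCDVS

/-- The (semi)norm `‖v‖_A = ⟨A v, v⟩^{1/2}` on `ℝⁿ` induced by a symmetric positive
semidefinite matrix `A`. -/
def matNorm {n : ℕ} (A : Matrix (Fin n) (Fin n) ℝ) (v : EuclideanSpace ℝ (Fin n)) : ℝ :=
  Real.sqrt ((A.mulVec v.ofLp) ⬝ᵥ v.ofLp)

/-- `f` is differentiable and 1-smooth with respect to `‖·‖_B`. -/
def IsOneSmooth {n : ℕ} (B : Matrix (Fin n) (Fin n) ℝ)
    (f : EuclideanSpace ℝ (Fin n) → ℝ) : Prop :=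
  Differentiable ℝ f ∧
    ∀ x y, f y ≤ f x + inner ℝ (gradient f x) (y - x) + 1 / 2 * matNorm B (y - x) ^ 2

/-- `f` is differentiable and strongly convex with respect to `‖·‖_A` with constant `m > 0`. -/
def IsStronglyConvex {n : ℕ} (A : Matrix (Fin n) (Fin n) ℝ) (m : ℝ)
    (f : EuclideanSpace ℝ (Fin n) → ℝ) : Prop :=
  Differentiable ℝ f ∧ 0 < m ∧
    ∀ x y, f x + inner ℝ (gradient f x) (y - x) + m / 2 * matNorm A (y - x) ^ 2 ≤ f y

/-- `B = Q Diag(lam) Qᵀ` is a spectral decomposition of `B` with `Q` orthogonal and with the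
eigenvalues listed in non-increasing order. -/
structure IsSpectralDecomposition {n : ℕ} (B Q : Matrix (Fin n) (Fin n) ℝ)
    (lam : Fin n → ℝ) : Prop where
  orthogonal : Q ∈ Matrix.orthogonalGroup (Fin n) ℝ
  antitone : Antitone lam
  decomposition : B = Q * Matrix.diagonal lam * Q.transpose

/-- The `τ`-coordinate approximation (for `1 ≤ τ ≤ n`)
`B_τ = Q Diag(λ₁, …, λ_τ, λ_τ, …, λ_τ) Qᵀ + (∑_{i > τ} λ_i) I` of `B = Q Diag(λ) Qᵀ`.
The indices in `Fin n` start from `0`, so `λ_τ` is `lam (τ - 1)`. -/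
def coordApprox {n : ℕ} (Q : Matrix (Fin n) (Fin n) ℝ) (lam : Fin n → ℝ) (τ : ℕ) :
    Matrix (Fin n) (Fin n) ℝ :=
  Q * Matrix.diagonal
      (fun i : Fin n => lam ⟨min i.val (τ - 1), lt_of_le_of_lt (min_le_left _ _) i.isLt⟩) *
      Q.transpose
    + (∑ i : Fin n with τ ≤ i.val, lam i) • (1 : Matrix (Fin n) (Fin n) ℝ)

/-- The collection of all `τ`-element subsets of the set of `n` coordinates. -/
abbrev CoordSet (n τ : ℕ) : Type := {S : Finset (Fin n) // S.card = τ}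

/-- The discrete `σ`-algebra on the (finite) collection of `τ`-element subsets. -/
instance (n τ : ℕ) : MeasurableSpace (CoordSet n τ) := ⊤

/-- The principal submatrix `B_{S × S}`. -/
def principal {n : ℕ} (B : Matrix (Fin n) (Fin n) ℝ) (S : Finset (Fin n)) : Matrix S S ℝ :=
  B.submatrix (fun i : S => (i : Fin n)) (fun i : S => (i : Fin n))

/-- The matrix `I_S`: the columns of the identity matrix whose indices are in `S`. -/
def colSelect {n : ℕ} (S : Finset (Fin n)) : Matrix (Fin n) S ℝ :=
  (1 : Matrix (Fin n) (Fin n) ℝ).submatrix id (fun i : S => (i : Fin n))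

/-- One iteration `x - I_S (B_{S × S})⁻¹ ∇f(x)_S`. -/
def step {n : ℕ} (f : EuclideanSpace ℝ (Fin n) → ℝ) (B : Matrix (Fin n) (Fin n) ℝ)
    (S : Finset (Fin n)) (x : EuclideanSpace ℝ (Fin n)) : EuclideanSpace ℝ (Fin n) :=
  x - WithLp.toLp 2
    ((colSelect S).mulVec ((principal B S)⁻¹.mulVec (fun i : S => gradient f x (i : Fin n))))

/-- `S ∼ Vol_τ(B)`: the random `τ`-element subset `S` is generated by `τ`-element volume
sampling with respect to `B`. -/
def IsVolumeSampling {n τ : ℕ} (B : Matrix (Fin n) (Fin n) ℝ) {Ω : Type*} [MeasurableSpace Ω]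
    (P : Measure Ω) (S : Ω → CoordSet n τ) : Prop :=
  Measurable S ∧
    ∀ T : CoordSet n τ, P.real {ω | S ω = T} =
      (principal B T.val).det / ∑ T' : CoordSet n τ, (principal B T'.val).det

/-- `x 0, …, x K` are the random points generated by the method `RCDVS(f, B, τ, x0, K)` with the
freshly drawn (mutually independent) random coordinate subsets `S 0, …, S (K - 1)`. -/
structure IsRCDVS {n τ K : ℕ} (f : EuclideanSpace ℝ (Fin n) → ℝ)
    (B : Matrix (Fin n) (Fin n) ℝ) (x0 : EuclideanSpace ℝ (Fin n))
    {Ω : Type*} [MeasurableSpace Ω] (P : Measure Ω)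
    (S : Fin K → Ω → CoordSet n τ) (x : Fin (K + 1) → Ω → EuclideanSpace ℝ (Fin n)) : Prop where
  sampling : ∀ k, IsVolumeSampling B P (S k)
  indep : iIndepFun S P
  init : ∀ ω, x 0 ω = x0
  next : ∀ (k : Fin K) (ω : Ω), x k.succ ω = step f B (S k ω).val (x k.castSucc ω)

end RCDVS

end

/-! Smoothness makes a step on the block `S` lower `f` by at least half of `g_Sᵀ (B_{S×S})⁻¹ g_S`,
where `g` is the gradient (`IsOneSmooth.step_le`). Under volume sampling the weight `det B_{S×S}`
turns the mean of this form into `volumeForm B τ g / minorSum B τ`. By the matrix determinant lemma,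
`volumeForm` is the change of `minorSum` under the rank-one update `B + g gᵀ`. Sums of principal
minors are, up to sign, coefficients of the characteristic polynomial, so everything is invariant
under orthogonal conjugation and `B` may be taken diagonal.

There the form is `∑ vᵢ² ∂ᵢe_τ(λ)`, and an exchange argument on `τ`-sets gives `e_τ ≤ Dᵢ ∂ᵢe_τ`,
with `Dᵢ` the eigenvalues of `B_τ` (`sum_prod_le_coordApproxEigenvalue_mul`). So the mean decrease
is at least half the squared dual `B_τ`-norm of `g`, which strong convexity bounds below by `μ_τ (f
x - min f)` (`IsStronglyConvex.gradient_dominated`). Independence of the current point and the next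
draw lets this one-step bound be iterated. -/

namespace RCDVS

open Finset Matrix

/-! ### Principal minors, volume sampling and elementary symmetric sums -/

section VolumeSampling

variable {ι : Type*} [Fintype ι] [DecidableEq ι]

/-- The sum of all principal minors of order `k`. -/
def minorSum (A : Matrix ι ι ℝ) (k : ℕ) : ℝ :=
  ∑ s ∈ univ.powersetCard k, (A.submatrix (Subtype.val : s → ι) (Subtype.val : s → ι)).det

lemma minorSum_orthogonal_conj {Q : Matrix ι ι ℝ} (hQ : Q ∈ orthogonalGroup ι ℝ)
    (M : Matrix ι ι ℝ) {k : ℕ} (hk : k ≤ Fintype.card ι) :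
    minorSum (Q * M * Qᵀ) k = minorSum M k := by
  have hQQ : Qᵀ * Q = 1 := (mem_orthogonalGroup_iff' ι ℝ).1 hQ
  have h : (Q * M * Qᵀ).charpoly = M.charpoly := by
    rw [charpoly_mul_comm, ← Matrix.mul_assoc, hQQ, Matrix.one_mul]
  have h1 := charpoly_coeff_eq_sum_minors (Q * M * Qᵀ) k hk
  rw [h, charpoly_coeff_eq_sum_minors M k hk] at h1
  exact (mul_left_cancel₀ (pow_ne_zero k (by norm_num)) h1).symm

lemma det_add_vecMulVec_self {A : Matrix ι ι ℝ} (hA : IsUnit A.det) (v : ι → ℝ) :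
    (A + vecMulVec v v).det = A.det + A.det * (v ⬝ᵥ A⁻¹ *ᵥ v) := by
  rw [vecMulVec_eq Unit, det_add_replicateCol_mul_replicateRow hA, Matrix.mul_assoc,
    ← replicateCol_mulVec, det_unique (1 + _ : Matrix Unit Unit ℝ), Matrix.add_apply, replicateRow_mul_replicateCol_apply, Matrix.one_apply_eq]
  ring

/-- The quadratic form of the matrix `∑ₛ det(A_{s×s}) I_s (A_{s×s})⁻¹ I_sᵀ`, the sum ranging over
the sets `s` of cardinality `k`. -/
noncomputable def volumeForm (A : Matrix ι ι ℝ) (k : ℕ) (v : ι → ℝ) : ℝ :=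
  ∑ s ∈ univ.powersetCard k, (A.submatrix (Subtype.val : s → ι) (Subtype.val : s → ι)).det *
    ((fun i : s => v i) ⬝ᵥ (A.submatrix (Subtype.val : s → ι) (Subtype.val : s → ι))⁻¹ *ᵥ
      (fun i : s => v i))

/-- The matrix determinant lemma on each principal block. Its purpose is to transfer the orthogonal
invariance of `minorSum` to `volumeForm`. -/
lemma minorSum_add_vecMulVec_self {A : Matrix ι ι ℝ} (hA : A.PosDef) (v : ι → ℝ) (k : ℕ) :
    minorSum (A + vecMulVec v v) k = minorSum A k + volumeForm A k v := by
  rw [minorSum, minorSum, volumeForm, ← sum_add_distrib]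
  refine sum_congr rfl fun s _ => ?_
  rw [← det_add_vecMulVec_self]
  · rfl
  · exact (hA.submatrix Subtype.val_injective).det_pos.ne'.isUnit

lemma volumeForm_orthogonal_conj {Q M : Matrix ι ι ℝ} (hQ : Q ∈ orthogonalGroup ι ℝ)
    (hM : M.PosDef) (hA : (Q * M * Qᵀ).PosDef) {k : ℕ} (hk : k ≤ Fintype.card ι) (v : ι → ℝ) :
    volumeForm (Q * M * Qᵀ) k v = volumeForm M k (Qᵀ *ᵥ v) := by
  have hQQ : Q * Qᵀ = 1 := (mem_orthogonalGroup_iff ι ℝ).1 hQ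
  have h1 := minorSum_add_vecMulVec_self hA v k
  have h2 := minorSum_add_vecMulVec_self hM (Qᵀ *ᵥ v) k
  have h3 : Q * M * Qᵀ + vecMulVec v v = Q * (M + vecMulVec (Qᵀ *ᵥ v) (Qᵀ *ᵥ v)) * Qᵀ := by
    rw [Matrix.mul_add, Matrix.add_mul, mul_vecMulVec, vecMulVec_mul, mulVec_mulVec, hQQ,
      vecMul_transpose, mulVec_mulVec, hQQ, one_mulVec]
  rw [h3, minorSum_orthogonal_conj hQ _ hk, minorSum_orthogonal_conj hQ _ hk] at h1
  linarith

lemma minorSum_diagonal (d : ι → ℝ) (k : ℕ) :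
    minorSum (diagonal d) k = ∑ s ∈ univ.powersetCard k, ∏ i ∈ s, d i := by
  refine sum_congr rfl fun s _ => ?_
  rw [submatrix_diagonal _ _ Subtype.val_injective, det_diagonal]
  exact prod_coe_sort s d

/-- The coefficient `∂e_k/∂dᵢ` of the `k`-th elementary symmetric polynomial `e_k`. -/
def esymmDeriv (d : ι → ℝ) (k : ℕ) (i : ι) : ℝ :=
  ∑ s ∈ univ.powersetCard k with i ∈ s, ∏ j ∈ s.erase i, d j

lemma volumeForm_diagonal {d : ι → ℝ} (hd : ∀ i, 0 < d i) (k : ℕ) (v : ι → ℝ) :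
    volumeForm (diagonal d) k v = ∑ i, v i ^ 2 * esymmDeriv d k i := by
  have h : volumeForm (diagonal d) k v =
      ∑ s ∈ univ.powersetCard k, ∑ i, if i ∈ s then v i ^ 2 * ∏ j ∈ s.erase i, d j else 0 := by
    refine sum_congr rfl fun s _ => ?_
    rw [submatrix_diagonal _ _ Subtype.val_injective, det_diagonal, Function.comp_def,
      prod_coe_sort s d, inv_diagonal, dotProduct, mul_sum, sum_ite_mem, univ_inter,
      ← sum_coe_sort s]
    refine sum_congr rfl fun i _ => ?_
    have hu : IsUnit (fun i : s => d i) := Pi.isUnit_iff.2 fun i => (hd i).ne'.isUnit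
    have hi : Ring.inverse (fun i : s => d i) i = (d i)⁻¹ := by
      have := congrFun (Ring.mul_inverse_cancel _ hu) i
      exact eq_inv_of_mul_eq_one_right this
    rw [mulVec_diagonal, hi, ← mul_prod_erase s d i.2]
    have := (hd i).ne'
    field_simp
  rw [h, sum_comm]
  refine sum_congr rfl fun i _ => ?_
  rw [esymmDeriv, mul_sum, sum_filter]

/-- Sets containing `i` contribute exactly `d i` times the derivative. A set avoiding `i` meets `T`
at some `j`; replacing `j` by `i` shows its product to be `d j` times a term of the derivative. -/
lemma sum_prod_le_mul_esymmDeriv {d : ι → ℝ} (hd : ∀ i, 0 ≤ d i) {k : ℕ} {i : ι} {T : Finset ι}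
    (hi : i ∉ T) (hT : ∀ s : Finset ι, s.card = k → i ∉ s → ∃ j ∈ T, j ∈ s) :
    ∑ s ∈ univ.powersetCard k, ∏ j ∈ s, d j ≤ (d i + ∑ j ∈ T, d j) * esymmDeriv d k i := by
  rw [← sum_filter_add_sum_filter_not _ (fun s => i ∈ s), add_mul]
  refine add_le_add (le_of_eq ?_) ?_
  · rw [esymmDeriv, mul_sum]
    exact sum_congr rfl fun s hs => (mul_prod_erase s d (mem_filter.1 hs).2).symm
  calc ∑ s ∈ univ.powersetCard k with i ∉ s, ∏ j ∈ s, d j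
      ≤ ∑ s ∈ univ.powersetCard k with i ∉ s, ∑ j ∈ T, if j ∈ s then ∏ l ∈ s, d l else 0 := by
        refine sum_le_sum fun s hs => ?_
        obtain ⟨hs, his⟩ := mem_filter.1 hs
        obtain ⟨j, hjT, hjs⟩ := hT s (mem_powersetCard.1 hs).2 his
        have := single_le_sum (f := fun j => if j ∈ s then ∏ l ∈ s, d l else 0)
          (fun j _ => by split_ifs; exacts [prod_nonneg fun l _ => hd l, le_rfl]) hjT
        simpa [hjs] using this
    _ = ∑ j ∈ T, ∑ s ∈ univ.powersetCard k with i ∉ s, if j ∈ s then ∏ l ∈ s, d l else 0 :=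
        sum_comm
    _ ≤ ∑ j ∈ T, d j * esymmDeriv d k i := by
        refine sum_le_sum fun j hj => ?_
        have hij : j ≠ i := fun h => hi (h ▸ hj)
        rw [← sum_filter, filter_filter]
        calc _ = ∑ s ∈ univ.powersetCard k with i ∈ s ∧ j ∉ s, d j * ∏ l ∈ s.erase i, d l := by
              -- Swapping `j` for `i` keeps the cardinality and is undone by the reverse swap.
              refine sum_nbij' (fun s => insert i (s.erase j)) (fun s => insert j (s.erase i))
                ?_ ?_ ?_ ?_ ?_
              · intro s hs
                simp only [mem_filter, mem_powersetCard, subset_univ, true_and] at hs ⊢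
                obtain ⟨hc, his, hjs⟩ := hs
                have : 0 < s.card := card_pos.2 ⟨j, hjs⟩
                refine ⟨?_, mem_insert_self _ _, by simp [hij]⟩
                rw [card_insert_of_notMem (by simp [his]), card_erase_of_mem hjs]
                omega
              · intro s hs
                simp only [mem_filter, mem_powersetCard, subset_univ, true_and] at hs ⊢
                obtain ⟨hc, his, hjs⟩ := hs
                have : 0 < s.card := card_pos.2 ⟨i, his⟩
                refine ⟨?_, by simp [hij.symm], mem_insert_self _ _⟩
                rw [card_insert_of_notMem (by simp [hjs]), card_erase_of_mem his]
                omega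
              · intro s hs
                simp only [mem_filter] at hs
                rw [erase_insert (by simp [hs.2.1]), insert_erase hs.2.2]
              · intro s hs
                simp only [mem_filter] at hs
                rw [erase_insert (by simp [hs.2.2]), insert_erase hs.2.1]
              · intro s hs
                simp only [mem_filter] at hs
                rw [erase_insert (by simp [hs.2.1]), mul_prod_erase _ _ hs.2.2]
          _ ≤ d j * esymmDeriv d k i := by
              rw [esymmDeriv, mul_sum]
              refine sum_le_sum_of_subset_of_nonneg ?_ fun s _ _ =>
                mul_nonneg (hd j) (prod_nonneg fun l _ => hd l)
              intro s hs
              simp only [mem_filter] at hs ⊢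
              exact ⟨hs.1, hs.2.1⟩
    _ = (∑ j ∈ T, d j) * esymmDeriv d k i := (sum_mul ..).symm

end VolumeSampling

/-! ### Eigenvalues of `B_τ` and the lower bound on the volume form -/

variable {n : ℕ}

/-- The eigenvalues of `coordApprox Q lam τ`. -/
def coordApproxEigenvalue (lam : Fin n → ℝ) (τ : ℕ) (i : Fin n) : ℝ :=
  lam ⟨min i.val (τ - 1), lt_of_le_of_lt (min_le_left _ _) i.isLt⟩ +
    ∑ i : Fin n with τ ≤ i.val, lam i

lemma sum_prod_le_coordApproxEigenvalue_mul {lam : Fin n → ℝ} (hlam : ∀ i, 0 < lam i) {τ : ℕ}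
    (hτ : 1 ≤ τ) (i : Fin n) :
    ∑ s ∈ univ.powersetCard τ, ∏ j ∈ s, lam j ≤
      coordApproxEigenvalue lam τ i * esymmDeriv lam τ i := by
  have hcard : ∀ (s : Finset (Fin n)) (m : ℕ), (∀ j ∈ s, j.val < m) → s.card ≤ m := by
    intro s m h
    simpa using card_le_card_of_injOn (t := range m) (fun j : Fin n => j.val)
      (fun j hj => by simpa using h j hj) (Fin.val_injective.injOn)
  rcases lt_or_ge i.val τ with hi | hi
  · have hmin : (⟨min i.val (τ - 1), lt_of_le_of_lt (min_le_left _ _) i.isLt⟩ : Fin n) = i := by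
      ext; simp; omega
    rw [coordApproxEigenvalue, hmin]
    -- Here `T` is the tail `{j ≥ τ}`: a `τ`-set avoiding both `T` and `i` would have to fit into `τ
    -- - 1` indices.
    refine sum_prod_le_mul_esymmDeriv (fun i => (hlam i).le) (by simpa using hi) ?_
    intro s hs his
    by_contra! h
    have := hcard (insert i s) τ (by
      intro j hj
      rcases mem_insert.1 hj with rfl | hj
      · exact hi
      · by_contra! hjτ
        exact h j (by simpa using hjτ) hj)
    rw [card_insert_of_notMem his] at this
    omega
  · set a : Fin n := ⟨min i.val (τ - 1), lt_of_le_of_lt (min_le_left _ _) i.isLt⟩ with ha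
    have hav : a.val = τ - 1 := by simp [ha]; omega
    have hT : univ.filter (fun j : Fin n => τ - 1 ≤ j.val) =
        insert a (univ.filter (fun j : Fin n => τ ≤ j.val)) := by
      ext j
      simp only [mem_filter, mem_univ, true_and, mem_insert, Fin.ext_iff, hav]
      omega
    -- For `i` in the tail, the capped eigenvalue at index `τ - 1` joins the tail sum, and `lam i`
    -- is split off instead. So `T` is `{j ≥ τ - 1}` without `i`, and only `τ - 1` indices lie below
    -- it.
    have hsum : coordApproxEigenvalue lam τ i =
        lam i + ∑ j ∈ (univ.filter (fun j : Fin n => τ - 1 ≤ j.val)).erase i, lam j := by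
      rw [add_sum_erase _ _ (by simp; omega), hT, sum_insert (by simp [hav]; omega)]
      rfl
    rw [hsum]
    refine sum_prod_le_mul_esymmDeriv (fun i => (hlam i).le) (by simp) ?_
    intro s hs his
    by_contra! h
    have := hcard s (τ - 1) (by
      intro j hj
      by_contra! hjτ
      have hji : j ≠ i := fun e => his (e ▸ hj)
      exact h j (by simpa [hji] using hjτ) hj)
    omega

lemma IsSpectralDecomposition.pos {B Q : Matrix (Fin n) (Fin n) ℝ} {lam : Fin n → ℝ}
    (hQ : IsSpectralDecomposition B Q lam) (hB : B.PosDef) (i : Fin n) : 0 < lam i := by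
  have hQQ : Qᵀ * Q = 1 := (mem_orthogonalGroup_iff' _ ℝ).1 hQ.orthogonal
  have hd : diagonal lam = Qᵀ * B * Q := by
    rw [hQ.decomposition]
    simp only [Matrix.mul_assoc, hQQ, Matrix.mul_one]
    rw [← Matrix.mul_assoc, hQQ, Matrix.one_mul]
  have h : (diagonal lam).PosDef := by
    rw [hd, ← conjTranspose_eq_transpose_of_trivial]
    refine hB.conjTranspose_mul_mul_same (mulVec_injective_of_isUnit ?_)
    exact IsUnit.of_mul_eq_one_right _ hQQ
  exact posDef_diagonal_iff.1 h i

lemma IsSpectralDecomposition.mul_sum_div_le_volumeForm {B Q : Matrix (Fin n) (Fin n) ℝ}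
    {lam : Fin n → ℝ} (hQ : IsSpectralDecomposition B Q lam) (hB : B.PosDef) {τ : ℕ} (hτ : 1 ≤ τ)
    (hτn : τ ≤ n) (v : Fin n → ℝ) :
    minorSum B τ * ∑ i, (Qᵀ *ᵥ v) i ^ 2 / coordApproxEigenvalue lam τ i ≤ volumeForm B τ v := by
  have hlam := hQ.pos hB
  have hn : τ ≤ Fintype.card (Fin n) := by simpa using hτn
  have hB' := hB
  rw [hQ.decomposition] at hB' ⊢
  rw [volumeForm_orthogonal_conj hQ.orthogonal (PosDef.diagonal hlam) hB' hn,
    minorSum_orthogonal_conj hQ.orthogonal _ hn, volumeForm_diagonal hlam, minorSum_diagonal,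
    mul_sum]
  refine sum_le_sum fun i _ => ?_
  have hD : 0 < coordApproxEigenvalue lam τ i :=
    add_pos_of_pos_of_nonneg (hlam _) (sum_nonneg fun i _ => (hlam i).le)
  rw [mul_div_assoc', div_le_iff₀ hD]
  nlinarith [mul_le_mul_of_nonneg_left (sum_prod_le_coordApproxEigenvalue_mul hlam hτ i)
    (sq_nonneg ((Qᵀ *ᵥ v) i))]

lemma minorSum_pos {B : Matrix (Fin n) (Fin n) ℝ} (hB : B.PosDef) {τ : ℕ} (hτn : τ ≤ n) :
    0 < minorSum B τ :=
  sum_pos (fun _ _ => (hB.submatrix Subtype.val_injective).det_pos)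
    (powersetCard_nonempty.2 (by simpa using hτn))

end RCDVS

/-! ### Deterministic analysis: strong convexity, smoothness and one step -/

namespace RCDVS

open Finset Matrix

variable {n : ℕ}

lemma dotProduct_orthogonal {Q : Matrix (Fin n) (Fin n) ℝ}
    (hQ : Q ∈ orthogonalGroup (Fin n) ℝ) (v w : Fin n → ℝ) :
    (Qᵀ *ᵥ v) ⬝ᵥ (Qᵀ *ᵥ w) = v ⬝ᵥ w := by
  have hQQ : Q * Qᵀ = 1 := (mem_orthogonalGroup_iff _ ℝ).1 hQ
  rw [mulVec_transpose, ← dotProduct_mulVec, mulVec_mulVec, hQQ, one_mulVec]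

lemma quadForm_orthogonal_conj_diagonal (Q : Matrix (Fin n) (Fin n) ℝ) (d : Fin n → ℝ)
    (z : Fin n → ℝ) :
    ((Q * diagonal d * Qᵀ) *ᵥ z) ⬝ᵥ z = ∑ i, d i * (Qᵀ *ᵥ z) i ^ 2 := by
  rw [← mulVec_mulVec, ← mulVec_mulVec, dotProduct_comm, dotProduct_mulVec, ← mulVec_transpose,
    dotProduct]
  refine sum_congr rfl fun i _ => ?_
  rw [mulVec_diagonal]
  ring

lemma matNorm_sq_orthogonal_conj_diagonal (Q : Matrix (Fin n) (Fin n) ℝ) {d : Fin n → ℝ}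
    (hd : ∀ i, 0 ≤ d i) (z : EuclideanSpace ℝ (Fin n)) :
    matNorm (Q * diagonal d * Qᵀ) z ^ 2 = ∑ i, d i * (Qᵀ *ᵥ z.ofLp) i ^ 2 := by
  rw [matNorm, quadForm_orthogonal_conj_diagonal, Real.sq_sqrt]
  exact sum_nonneg fun i _ => mul_nonneg (hd i) (sq_nonneg _)

lemma coordApprox_eq {Q : Matrix (Fin n) (Fin n) ℝ} (hQ : Q ∈ orthogonalGroup (Fin n) ℝ)
    (lam : Fin n → ℝ) (τ : ℕ) :
    coordApprox Q lam τ = Q * diagonal (coordApproxEigenvalue lam τ) * Qᵀ := by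
  have hQQ : Q * Qᵀ = 1 := (mem_orthogonalGroup_iff _ ℝ).1 hQ
  have h : diagonal (coordApproxEigenvalue lam τ) =
      diagonal (fun i : Fin n =>
        lam ⟨min i.val (τ - 1), lt_of_le_of_lt (min_le_left _ _) i.isLt⟩) +
      (∑ i : Fin n with τ ≤ i.val, lam i) • (1 : Matrix (Fin n) (Fin n) ℝ) := by
    rw [smul_one_eq_diagonal, diagonal_add]
    rfl
  rw [h, Matrix.mul_add, Matrix.add_mul, Matrix.mul_smul, Matrix.smul_mul, Matrix.mul_one, hQQ]
  rfl

lemma coordApproxEigenvalue_pos {lam : Fin n → ℝ} (hlam : ∀ i, 0 < lam i) (τ : ℕ) (i : Fin n) :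
    0 < coordApproxEigenvalue lam τ i :=
  add_pos_of_pos_of_nonneg (hlam _) (sum_nonneg fun i _ => (hlam i).le)

lemma real_inner_eq_dotProduct (v w : EuclideanSpace ℝ (Fin n)) :
    inner ℝ v w = v.ofLp ⬝ᵥ w.ofLp := by
  rw [EuclideanSpace.inner_eq_star_dotProduct, dotProduct_comm]
  rfl

lemma IsStronglyConvex.lower_bound {B Q : Matrix (Fin n) (Fin n) ℝ} {lam : Fin n → ℝ}
    (hQ : IsSpectralDecomposition B Q lam) (hB : B.PosDef) {τ : ℕ}
    {f : EuclideanSpace ℝ (Fin n) → ℝ} {m : ℝ} (hm : IsStronglyConvex (coordApprox Q lam τ) m f)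
    (x y : EuclideanSpace ℝ (Fin n)) :
    f x + (gradient f x).ofLp ⬝ᵥ (y - x).ofLp +
      m / 2 * ∑ i, coordApproxEigenvalue lam τ i * (Qᵀ *ᵥ (y - x).ofLp) i ^ 2 ≤ f y := by
  rw [← matNorm_sq_orthogonal_conj_diagonal Q
    (fun i => (coordApproxEigenvalue_pos (hQ.pos hB) τ i).le), ← coordApprox_eq hQ.orthogonal,
    ← real_inner_eq_dotProduct]
  exact hm.2.2 x y

/-- A Polyak–Łojasiewicz inequality: minimize the strongly convex lower bound over the displacement,
one eigendirection at a time. -/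
lemma IsStronglyConvex.gradient_dominated {B Q : Matrix (Fin n) (Fin n) ℝ} {lam : Fin n → ℝ}
    (hQ : IsSpectralDecomposition B Q lam) (hB : B.PosDef) {τ : ℕ}
    {f : EuclideanSpace ℝ (Fin n) → ℝ} {m : ℝ} (hm : IsStronglyConvex (coordApprox Q lam τ) m f)
    (x y : EuclideanSpace ℝ (Fin n)) :
    m * (f x - f y) ≤
      1 / 2 * ∑ i, (Qᵀ *ᵥ (gradient f x).ofLp) i ^ 2 / coordApproxEigenvalue lam τ i := by
  have h := IsStronglyConvex.lower_bound hQ hB hm x y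
  have hm0 := hm.2.1
  rw [← dotProduct_orthogonal hQ.orthogonal, dotProduct] at h
  set w := Qᵀ *ᵥ (gradient f x).ofLp
  set z := Qᵀ *ᵥ (y - x).ofLp
  set D := coordApproxEigenvalue lam τ with hD
  -- Completing the square; the lower bound is multiplied by `m` beforehand.
  have key : ∀ i, -(1 / 2 * (w i ^ 2 / D i)) ≤ m * (w i * z i) + m * (m / 2 * (D i * z i ^ 2)) := by
    intro i
    have hDi : 0 < D i := coordApproxEigenvalue_pos (hQ.pos hB) τ i
    have : m * (w i * z i) + m * (m / 2 * (D i * z i ^ 2)) + 1 / 2 * (w i ^ 2 / D i) =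
        (w i + m * D i * z i) ^ 2 / (2 * D i) := by
      field_simp
      ring
    have : 0 ≤ (w i + m * D i * z i) ^ 2 / (2 * D i) := by positivity
    linarith
  have hs := sum_le_sum fun i (_ : i ∈ univ) => key i
  rw [sum_add_distrib, sum_neg_distrib] at hs
  simp only [← mul_sum] at hs
  nlinarith [mul_le_mul_of_nonneg_left h hm0.le]

lemma IsStronglyConvex.exists_isLeast {B Q : Matrix (Fin n) (Fin n) ℝ} {lam : Fin n → ℝ}
    (hn : 0 < n) (hQ : IsSpectralDecomposition B Q lam) (hB : B.PosDef) {τ : ℕ}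
    {f : EuclideanSpace ℝ (Fin n) → ℝ} {m : ℝ} (hm : IsStronglyConvex (coordApprox Q lam τ) m f) :
    ∃ fmin, IsLeast (Set.range f) fmin := by
  have : Nonempty (Fin n) := ⟨⟨0, hn⟩⟩
  obtain ⟨i₀, hi₀⟩ := Finite.exists_min (coordApproxEigenvalue lam τ)
  set c := coordApproxEigenvalue lam τ i₀
  have hc : 0 < c := coordApproxEigenvalue_pos (hQ.pos hB) τ i₀
  have hm0 := hm.2.1
  -- Coercivity: the smallest eigenvalue `c` gives quadratic growth that beats the linear term.
  have hlow : ∀ y, f 0 + ‖y‖ * (m / 2 * c * ‖y‖ - ‖gradient f 0‖) ≤ f y := by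
    intro y
    have h := IsStronglyConvex.lower_bound hQ hB hm 0 y
    rw [← real_inner_eq_dotProduct, sub_zero] at h
    have h1 := neg_le_of_abs_le (abs_real_inner_le_norm (gradient f 0) y)
    have h2 : c * ‖y‖ ^ 2 ≤ ∑ i, coordApproxEigenvalue lam τ i * (Qᵀ *ᵥ y.ofLp) i ^ 2 := by
      rw [← real_inner_self_eq_norm_sq, real_inner_eq_dotProduct,
        ← dotProduct_orthogonal hQ.orthogonal, dotProduct, mul_sum]
      exact sum_le_sum fun i _ => by
        rw [← sq]; exact mul_le_mul_of_nonneg_right (hi₀ i) (sq_nonneg _)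
    nlinarith [mul_le_mul_of_nonneg_left h2 (half_pos hm0).le]
  have ht : Filter.Tendsto f (Filter.cocompact _) Filter.atTop := by
    refine Filter.tendsto_atTop_mono hlow (Filter.tendsto_atTop_add_const_left _ _ ?_)
    have hN := tendsto_norm_cocompact_atTop (E := EuclideanSpace ℝ (Fin n))
    refine hN.atTop_mul_atTop₀ ?_
    simp only [sub_eq_add_neg]
    exact Filter.tendsto_atTop_add_const_right _ _ (hN.const_mul_atTop (by positivity))
  obtain ⟨x, hx⟩ := hm.1.continuous.exists_forall_le ht
  exact ⟨f x, ⟨x, rfl⟩, by rintro _ ⟨y, rfl⟩; exact hx y⟩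

/-- Along the top eigenvector the two quadratic bounds compare as `m * D ≤ λ₁ ≤ D`. This makes the
contraction factor nonnegative. -/
lemma IsStronglyConvex.le_one {B Q : Matrix (Fin n) (Fin n) ℝ} {lam : Fin n → ℝ}
    (hn : 0 < n) (hQ : IsSpectralDecomposition B Q lam) (hB : B.PosDef) {τ : ℕ}
    {f : EuclideanSpace ℝ (Fin n) → ℝ} (hf : IsOneSmooth B f) {m : ℝ}
    (hm : IsStronglyConvex (coordApprox Q lam τ) m f) : m ≤ 1 := by
  have hQQ : Qᵀ * Q = 1 := (mem_orthogonalGroup_iff' _ ℝ).1 hQ.orthogonal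
  set i₀ : Fin n := ⟨0, hn⟩
  set z : EuclideanSpace ℝ (Fin n) := WithLp.toLp 2 (Q *ᵥ Pi.single i₀ 1)
  have hz : Qᵀ *ᵥ z.ofLp = Pi.single i₀ 1 := by
    simp only [z, mulVec_mulVec, hQQ, one_mulVec]
  have hsum : ∀ d : Fin n → ℝ, ∑ i, d i * (Qᵀ *ᵥ z.ofLp) i ^ 2 = d i₀ := by
    intro d
    rw [hz, sum_eq_single i₀] <;> simp +contextual
  have h1 := IsStronglyConvex.lower_bound hQ hB hm 0 z
  have h2 := hf.2 0 z
  rw [hQ.decomposition, matNorm_sq_orthogonal_conj_diagonal Q fun i => (hQ.pos hB i).le] at h2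
  rw [sub_zero, hsum] at h1 h2
  rw [real_inner_eq_dotProduct] at h2
  have hD : lam i₀ ≤ coordApproxEigenvalue lam τ i₀ := by
    have : (⟨min i₀.val (τ - 1), lt_of_le_of_lt (min_le_left _ _) i₀.isLt⟩ : Fin n) = i₀ := by
      ext; simp [i₀]
    rw [coordApproxEigenvalue, this]
    exact le_add_of_nonneg_right (sum_nonneg fun i _ => (hQ.pos hB i).le)
  have hpos := coordApproxEigenvalue_pos (hQ.pos hB) τ i₀
  refine le_of_mul_le_mul_right ?_ hpos
  linarith

/-- The step minimizes the quadratic upper model over the coordinates in `S`: the linear term is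
`-(g ⬝ᵥ u)`, and the quadratic one gives back half of it. -/
lemma IsOneSmooth.step_le {B : Matrix (Fin n) (Fin n) ℝ} (hB : B.PosDef)
    {f : EuclideanSpace ℝ (Fin n) → ℝ} (hf : IsOneSmooth B f) (S : Finset (Fin n))
    (x : EuclideanSpace ℝ (Fin n)) :
    f (step f B S x) ≤ f x - 1 / 2 * ((fun i : S => gradient f x i) ⬝ᵥ
      (principal B S)⁻¹ *ᵥ (fun i : S => gradient f x i)) := by
  set g : S → ℝ := fun i => gradient f x i with hg
  set u : S → ℝ := (principal B S)⁻¹ *ᵥ g with hu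
  have hdet : IsUnit (principal B S).det :=
    (hB.submatrix Subtype.val_injective).det_pos.ne'.isUnit
  have hBu : principal B S *ᵥ u = g := by
    rw [hu, mulVec_mulVec, mul_nonsing_inv _ hdet, one_mulVec]
  have hcol : (colSelect S)ᵀ *ᵥ (gradient f x).ofLp = g := by
    ext i
    simp [colSelect, mulVec, dotProduct, one_apply, hg]
  have hP : (colSelect S)ᵀ * B * colSelect S = principal B S := by
    ext i j
    simp [colSelect, mul_apply, one_apply, principal]
  have hstep : step f B S x - x = WithLp.toLp 2 (-(colSelect S *ᵥ u)) := by
    rw [step, sub_sub_cancel_left]; rfl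
  have h := hf.2 x (step f B S x)
  have hquad : matNorm B (step f B S x - x) ^ 2 = g ⬝ᵥ u := by
    have hq : (B *ᵥ (step f B S x - x).ofLp) ⬝ᵥ (step f B S x - x).ofLp = g ⬝ᵥ u := by
      rw [hstep]
      simp only [mulVec_neg, neg_dotProduct_neg]
      rw [mulVec_mulVec, dotProduct_mulVec, ← mulVec_transpose, mulVec_mulVec,
        ← Matrix.mul_assoc, hP, hBu]
    rw [matNorm, Real.sq_sqrt, hq]
    have := hB.posSemidef.dotProduct_mulVec_nonneg (step f B S x - x).ofLp
    rwa [dotProduct_comm] at this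
  have hinner : inner ℝ (gradient f x) (step f B S x - x) = -(g ⬝ᵥ u) := by
    rw [real_inner_eq_dotProduct, hstep]
    simp only [dotProduct_neg]
    rw [dotProduct_mulVec, ← mulVec_transpose, hcol]
  rw [hquad, hinner] at h
  linarith

lemma sum_coordSet {τ : ℕ} (F : Finset (Fin n) → ℝ) :
    ∑ T : CoordSet n τ, F T.val = ∑ s ∈ univ.powersetCard τ, F s :=
  (sum_subtype _ (fun s => by simp [mem_powersetCard]) F).symm

/-- The expected value of `f` contracts towards any value of `f` in one iteration. -/
lemma sum_step_le {B Q : Matrix (Fin n) (Fin n) ℝ} {lam : Fin n → ℝ} {τ : ℕ} (hτ : 1 ≤ τ)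
    (hτn : τ ≤ n) (hQ : IsSpectralDecomposition B Q lam) (hB : B.PosDef)
    {f : EuclideanSpace ℝ (Fin n) → ℝ} (hf : IsOneSmooth B f) {m : ℝ}
    (hm : IsStronglyConvex (coordApprox Q lam τ) m f) (x y : EuclideanSpace ℝ (Fin n)) :
    ∑ T : CoordSet n τ, (principal B T.val).det / (∑ T' : CoordSet n τ, (principal B T'.val).det) *
      f (step f B T.val x) ≤ f x - m * (f x - f y) := by
  have hM : ∑ T' : CoordSet n τ, (principal B T'.val).det = minorSum B τ :=
    sum_coordSet fun s => (principal B s).det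
  have hpos := minorSum_pos hB hτn
  have hdom := IsStronglyConvex.gradient_dominated hQ hB hm x y
  have hvol := hQ.mul_sum_div_le_volumeForm hB hτ hτn (gradient f x).ofLp
  rw [hM, sum_coordSet fun s => (principal B s).det / minorSum B τ * f (step f B s x)]
  calc _ ≤ ∑ s ∈ univ.powersetCard τ, (principal B s).det / minorSum B τ *
        (f x - 1 / 2 * ((fun i : s => gradient f x i) ⬝ᵥ
          (principal B s)⁻¹ *ᵥ (fun i : s => gradient f x i))) :=
        sum_le_sum fun s _ => mul_le_mul_of_nonneg_left (hf.step_le hB s x)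
          (div_nonneg (hB.submatrix Subtype.val_injective).det_pos.le hpos.le)
    _ = (minorSum B τ * f x - 1 / 2 * volumeForm B τ (gradient f x).ofLp) / minorSum B τ := by
        rw [minorSum, sum_mul, volumeForm, mul_sum, ← sum_sub_distrib, sum_div]
        refine sum_congr rfl fun s _ => ?_
        simp only [principal]
        ring
    _ ≤ f x - m * (f x - f y) := by
        rw [div_le_iff₀ hpos]
        nlinarith [mul_le_mul_of_nonneg_left hdom hpos.le]

/-! ### Expectations over the random coordinate sets -/

section Expectation

variable {Ω : Type*} [MeasurableSpace Ω] {P : Measure Ω} [IsProbabilityMeasure P]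

lemma integrable_comp_of_finite {α : Type*} [MeasurableSpace α] [Finite α]
    [MeasurableSingletonClass α] {X : Ω → α} (hX : Measurable X) (F : α → ℝ) :
    Integrable (fun ω => F (X ω)) P :=
  haveI := Measure.isProbabilityMeasure_map (μ := P) hX.aemeasurable
  (Integrable.of_finite (μ := P.map X) (f := F)).comp_measurable hX

lemma integral_comp_of_indepFun {α β : Type*} [MeasurableSpace α] [Fintype α]
    [MeasurableSingletonClass α] [MeasurableSpace β] [Finite β] [MeasurableSingletonClass β]
    {X : Ω → β} {Y : Ω → α} (hX : Measurable X) (hY : Measurable Y) (h : IndepFun X Y P)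
    (F : α → β → ℝ) :
    ∫ ω, F (Y ω) (X ω) ∂P = ∑ a, P.real {ω | Y ω = a} * ∫ ω, F a (X ω) ∂P := by
  classical
  have hF : ∀ ω, F (Y ω) (X ω) = ∑ a, F a (X ω) * (if Y ω = a then 1 else 0) := by
    intro ω
    simp
  simp_rw [hF]
  rw [integral_finsetSum]
  · refine sum_congr rfl fun a _ => ?_
    have hi : IndepFun (fun ω => F a (X ω)) (fun ω => if Y ω = a then (1 : ℝ) else 0) P :=
      h.comp (φ := F a) (ψ := fun b => if b = a then (1 : ℝ) else 0)
        (measurable_of_finite _) (measurable_of_finite _)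
    rw [hi.integral_fun_mul_eq_mul_integral
      (integrable_comp_of_finite hX (F a)).aestronglyMeasurable
      (integrable_comp_of_finite hY fun b => if b = a then (1 : ℝ) else 0).aestronglyMeasurable,
      mul_comm]
    congr 1
    have : (fun ω => if Y ω = a then (1 : ℝ) else 0) = {ω | Y ω = a}.indicator 1 := by
      ext ω; simp [Set.indicator_apply]
    rw [this]
    exact integral_indicator_one (hY (measurableSet_singleton a))
  · intro a _
    exact integrable_comp_of_finite (hX.prodMk hY)
      (fun p : β × α => F a p.1 * if p.2 = a then 1 else 0)

instance (n τ : ℕ) : MeasurableSingletonClass (CoordSet n τ) := ⟨fun _ => trivial⟩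

-- Each iterate is determined by the earlier draws, which form a finite-valued variable. This
-- supplies both integrability and independence from the next draw.
omit [IsProbabilityMeasure P] in
lemma IsRCDVS.exists_eq_comp {τ K : ℕ} {f : EuclideanSpace ℝ (Fin n) → ℝ}
    {B : Matrix (Fin n) (Fin n) ℝ} {x0 : EuclideanSpace ℝ (Fin n)}
    {S : Fin K → Ω → CoordSet n τ} {x : Fin (K + 1) → Ω → EuclideanSpace ℝ (Fin n)}
    (hx : IsRCDVS f B x0 P S x) (k : Fin (K + 1)) :
    ∃ G : (((univ.filter fun j : Fin K => j.castSucc < k) : Finset (Fin K)) → CoordSet n τ) →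
        EuclideanSpace ℝ (Fin n),
      ∀ ω, x k ω = G fun j => S j ω := by
  induction k using Fin.induction with
  | zero => exact ⟨fun _ => x0, hx.init⟩
  | succ k ih =>
    obtain ⟨G, hG⟩ := ih
    refine ⟨fun t => step f B (t ⟨k, by simp⟩).val (G fun j => t ⟨j, ?_⟩), fun ω => ?_⟩
    · have := (mem_filter.1 j.2).2
      exact mem_filter.2 ⟨mem_univ _, this.trans Fin.castSucc_lt_succ⟩
    · rw [hx.next, hG]

lemma IsRCDVS.integrable {τ K : ℕ} {f : EuclideanSpace ℝ (Fin n) → ℝ}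
    {B : Matrix (Fin n) (Fin n) ℝ} {x0 : EuclideanSpace ℝ (Fin n)}
    {S : Fin K → Ω → CoordSet n τ} {x : Fin (K + 1) → Ω → EuclideanSpace ℝ (Fin n)}
    (hx : IsRCDVS f B x0 P S x) (k : Fin (K + 1)) (F : EuclideanSpace ℝ (Fin n) → ℝ) :
    Integrable (fun ω => F (x k ω)) P := by
  obtain ⟨G, hG⟩ := hx.exists_eq_comp k
  simp_rw [hG]
  have hT : Measurable fun ω (j : (univ.filter fun j : Fin K => j.castSucc < k :
      Finset (Fin K))) => S j ω := measurable_pi_lambda _ fun j => (hx.sampling j.1).1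
  exact integrable_comp_of_finite hT fun t => F (G t)

lemma IsRCDVS.integral_succ {τ K : ℕ} {f : EuclideanSpace ℝ (Fin n) → ℝ}
    {B : Matrix (Fin n) (Fin n) ℝ} {x0 : EuclideanSpace ℝ (Fin n)}
    {S : Fin K → Ω → CoordSet n τ} {x : Fin (K + 1) → Ω → EuclideanSpace ℝ (Fin n)}
    (hx : IsRCDVS f B x0 P S x) (k : Fin K) :
    ∫ ω, f (x k.succ ω) ∂P = ∫ ω, ∑ T : CoordSet n τ, (principal B T.val).det /
      (∑ T' : CoordSet n τ, (principal B T'.val).det) * f (step f B T.val (x k.castSucc ω)) ∂P := by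
  obtain ⟨G, hG⟩ := hx.exists_eq_comp k.castSucc
  have hS : ∀ j, Measurable (S j) := fun j => (hx.sampling j).1
  have hind := hx.indep.indepFun_finset
    (univ.filter fun j : Fin K => j.castSucc < k.castSucc) {k} (by simp) hS
  have hind' : IndepFun (fun ω (j : (univ.filter fun j : Fin K => j.castSucc < k.castSucc :
      Finset (Fin K))) => S j ω) (S k) P :=
    hind.comp (φ := id)
      (ψ := fun t : (({k} : Finset (Fin K)) → CoordSet n τ) => t ⟨k, mem_singleton_self k⟩)
      measurable_id (measurable_pi_apply _)
  rw [integral_finsetSum _ fun T _ =>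
    (hx.integrable k.castSucc fun y => f (step f B T.val y)).const_mul _]
  simp_rw [integral_const_mul, hx.next, hG, ← (hx.sampling k).2]
  have hT : Measurable fun ω (j : (univ.filter fun j : Fin K => j.castSucc < k.castSucc :
      Finset (Fin K))) => S j ω := measurable_pi_lambda _ fun j => hS j.1
  exact integral_comp_of_indepFun hT (hS k) hind' fun T t => f (step f B T.val (G t))

end Expectation

end RCDVS

theorem theorem3p8 {n τ K : ℕ} (hτ : 1 ≤ τ) (hτn : τ ≤ n) (hK : 1 ≤ K)
    (B : Matrix (Fin n) (Fin n) ℝ) (hB : B.PosDef)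
    (Q : Matrix (Fin n) (Fin n) ℝ) (lam : Fin n → ℝ)
    (hQ : RCDVS.IsSpectralDecomposition B Q lam)
    (f : EuclideanSpace ℝ (Fin n) → ℝ) (hf : RCDVS.IsOneSmooth B f)
    (μτ : ℝ) (hμ : RCDVS.IsStronglyConvex (RCDVS.coordApprox Q lam τ) μτ f)
    (x0 : EuclideanSpace ℝ (Fin n))
    {Ω : Type*} [MeasurableSpace Ω] (P : Measure Ω) [IsProbabilityMeasure P]
    (S : Fin K → Ω → RCDVS.CoordSet n τ) (x : Fin (K + 1) → Ω → EuclideanSpace ℝ (Fin n))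
    (hx : RCDVS.IsRCDVS f B x0 P S x) :
    ∃ fmin : ℝ, IsLeast (Set.range f) fmin ∧
      ∀ k : Fin (K + 1),
        Integrable (fun ω => f (x k ω)) P ∧
          (∫ ω, f (x k ω) ∂P) - fmin ≤ (1 - μτ) ^ k.val * (f x0 - fmin) := by
  obtain ⟨fmin, hmin⟩ := RCDVS.IsStronglyConvex.exists_isLeast (by omega) hQ hB hμ
  refine ⟨fmin, hmin, fun k => ⟨hx.integrable k f, ?_⟩⟩
  obtain ⟨y, rfl⟩ := hmin.1
  have h1 : μτ ≤ 1 := RCDVS.IsStronglyConvex.le_one (by omega) hQ hB hf hμ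
  induction k using Fin.induction with
  | zero => simp [hx.init]
  | succ k ih =>
    have hle : ∫ ω, f (x k.succ ω) ∂P ≤
        ∫ ω, (f (x k.castSucc ω) - μτ * (f (x k.castSucc ω) - f y)) ∂P := by
      rw [hx.integral_succ]
      exact integral_mono (hx.integrable k.castSucc fun z => ∑ T : RCDVS.CoordSet n τ,
          (RCDVS.principal B T.val).det /
            (∑ T' : RCDVS.CoordSet n τ, (RCDVS.principal B T'.val).det) *
            f (RCDVS.step f B T.val z))
        (hx.integrable k.castSucc fun z => f z - μτ * (f z - f y))
        fun ω => RCDVS.sum_step_le hτ hτn hQ hB hf hμ _ y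
    have hi := hx.integrable k.castSucc f
    have heq : ∫ ω, (f (x k.castSucc ω) - μτ * (f (x k.castSucc ω) - f y)) ∂P =
        (∫ ω, f (x k.castSucc ω) ∂P) - μτ * ((∫ ω, f (x k.castSucc ω) ∂P) - f y) := by
      have hd : Integrable (fun ω => f (x k.castSucc ω) - f y) P := hi.sub (integrable_const _)
      rw [integral_sub hi (hd.const_mul μτ), integral_const_mul,
        integral_sub hi (integrable_const _)]
      simp
    calc (∫ ω, f (x k.succ ω) ∂P) - f y
        ≤ (1 - μτ) * ((∫ ω, f (x k.castSucc ω) ∂P) - f y) := by linarith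
      -- Multiplying the induction hypothesis by `1 - μτ` requires `μτ ≤ 1`.
      _ ≤ (1 - μτ) * ((1 - μτ) ^ k.castSucc.val * (f x0 - f y)) :=
          mul_le_mul_of_nonneg_left ih (sub_nonneg.2 h1)
      _ = (1 - μτ) ^ k.succ.val * (f x0 - f y) := by
          simp [pow_succ]; ring
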